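/- **Theorem 2.5.** For a prime $p$, a subgroup $G$ of $\mathbb{F}_p^*$ and a function $\varphi:G\to\mathbb{F}_p$, put $\mu(\varphi)=\max_{t\in\mathbb{F}_p}|\{x\in G:\varphi(x)=t\}|$; for $F:G\times G\to\mathbb{F}_p$ and $A\subset G$ put $F(A,A)=\{F(a,b):a,b\in A\}$. Let $1/2<\alpha<1$. Then there is $\Delta=\Delta(\alpha)>0$, and in fact one may take $$\Delta(\alpha)=\frac{1}{40}\min\left(2-\frac1\alpha,\ \frac1\alpha-1\right),$$ such that for every integer $k\ge 1$, every integer $M\ge 0$ and all real numbers $0<c_1<c_2$ there is a constant $\kappa>0$ (depending only on $\alpha,k,M,c_1,c_2$) with the following property. Let $p$ be a prime, $G$ a subgroup of $\mathbb{F}_p^*$, and let $g,h:G\to\mathbb{F}_p^*$ be functions such that * for every $z\in G$, each of the functions $x\mapsto g(xz)/g(x)$ and $x\mapsto h(xz)/h(x)$ takes at most $M$ different values on $G$; * for every $u\in G$, $\mu\big(x\mapsto g(x)\,h(ux)\,x\big)\le M$. Let $f(x,y)=g(x)h(y)(x^k+y^k)$ for $x,y\in G$, let $w:G\to\mathbb{F}_p$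 satisfy $\mu(w)\le M$, and let $P_w(f)(x,y)=w(x)f(x,y)$. Then for every $A\subset G$ with $c_1p^\alpha<|A|<c_2p^\alpha$, $$\max\big(|f(A,A)|,\ |P_w(f)(A,A)|\big)\ \ge\ \kappa\,|A|^{1+\Delta}.$$ -/

import Mathlib

section Expansion

open Classical in
/-- `μ(φ)`: the largest number of solutions `x ∈ G` of the equation `φ(x) = t`, over all `t ∈ 𝔽_p`,
for a function `φ : G → 𝔽_p` on a subgroup `G` of `𝔽_p^*`. -/
noncomputable def maxFiber {p : ℕ} [Fact p.Prime] (G : Subgroup (ZMod p)ˣ) (φ : G → ZMod p) : ℕ :=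
  Finset.univ.sup fun t : ZMod p => (Finset.univ.filter fun x : G => φ x = t).card

/-- The hypotheses on `g, h : G → 𝔽_p^*`, with `M` for the bound `O(1)`: for each fixed `z ∈ G` the
quotients `g(xz)/g(x)` and `h(xz)/h(x)` take at most `M` different values when `x` runs over `G`,
and `μ(g · h_u · id) ≤ M` for all `u ∈ G`, where `h_u(x) = h(ux)`. -/
structure IsAdmissiblePair {p : ℕ} [Fact p.Prime] (G : Subgroup (ZMod p)ˣ)
    (g h : G → (ZMod p)ˣ) (M : ℕ) : Prop where
  quotient_left : ∀ z : G, (Set.range fun x : G => g (x * z) / g x).ncard ≤ M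
  quotient_right : ∀ z : G, (Set.range fun x : G => h (x * z) / h x).ncard ≤ M
  fiber : ∀ u : G,
    maxFiber G (fun x : G => (g x : ZMod p) * (h (u * x) : ZMod p) * ((x : (ZMod p)ˣ) : ZMod p)) ≤ M

/-- The function `f(x, y) = g(x) h(y) (x^k + y^k)` on `G × G`. -/
def powerSumFun {p : ℕ} (G : Subgroup (ZMod p)ˣ) (g h : G → (ZMod p)ˣ) (k : ℕ) (x y : G) :
    ZMod p :=
  (g x : ZMod p) * (h y : ZMod p) *
    (((x : (ZMod p)ˣ) : ZMod p) ^ k + ((y : (ZMod p)ˣ) : ZMod p) ^ k)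

/-- The multiplicative `w`-shifted function `P_w(f)(x, y) = w(x) f(x, y)`. -/
def mulShift {p : ℕ} {G : Subgroup (ZMod p)ˣ} (w : G → ZMod p) (f : G → G → ZMod p) (x y : G) :
    ZMod p :=
  w x * f x y

end Expansion

open Finset

/-! Let `X` be the larger image size and `N = |A|`. The set `V` of pairs `(x, f(x, y))` has size at
least about `N ^ 2`, because `y ↦ f(x, y)` is boundedly many to one on average over `x`
(`sq_card_le_mul_card_valuePairs`). The map `(x, s) ↦ w(x) s` sends `V` into the image of `P_w(f)`,
so by Cauchy–Schwarz it has at least `|V| ^ 2 / X` collisions.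

A collision `w(x) f(x, y) = w(x') s'` reads `x^k + y^k = (w(x') / (w(x) g(x))) * (s' / h(y))`, an
incidence between a point given by `(x, x')` and a line given by `(y, s')`. There are at most `N ^
2` points and `N X` lines, with bounded multiplicities, so the second-moment incidence bound
`card_incidences_le` gives `N ^ 4 ≪ X (N ^ 3 X / p + √(p N ^ 3 X))`. Hence `N p ≪ X ^ 2` or `N ^ 5 ≪
p X ^ 3`, and `p ≈ N ^ (1 / α)` turns both into power gains. -/

/-- Cauchy–Schwarz for collisions: a map into a set of size `#t` has at least `#s ^ 2 / #t`
colliding pairs. -/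
theorem card_sq_le_card_mul_card_collisions {ι β : Type*} [DecidableEq β] (s : Finset ι)
    (t : Finset β) (φ : ι → β) (hφ : ∀ i ∈ s, φ i ∈ t) :
    s.card ^ 2 ≤ t.card * ((s ×ˢ s).filter fun q => φ q.1 = φ q.2).card := by
  have h1 : s.card = ∑ b ∈ t, (s.filter fun i => φ i = b).card :=
    card_eq_sum_card_fiberwise hφ
  have h2 : ((s ×ˢ s).filter fun q => φ q.1 = φ q.2).card
      = ∑ b ∈ t, (s.filter fun i => φ i = b).card ^ 2 := by
    rw [card_eq_sum_card_fiberwise (f := fun q : ι × ι => φ q.1) (t := t)]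
    · refine sum_congr rfl fun b _ => ?_
      rw [sq, ← card_product]
      congr 1
      ext ⟨i, j⟩
      simp only [mem_filter, mem_product]
      grind
    · intro q hq
      simp only [coe_filter, mem_product, Set.mem_ofPred_eq] at hq
      exact hφ _ hq.1.1
  rw [h1, h2]
  exact sq_sum_le_card_mul_sum_sq

/-! ### Point-line incidences over a finite field -/

section Incidence

variable {F : Type*} [Field F] [Fintype F] [DecidableEq F]

theorem sum_card_incidences {ι : Type*} (P : Finset ι) (a b : ι → F) :
    ∑ l : F × F, (P.filter fun i => a i + l.1 = b i * l.2).card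
      = P.card * Fintype.card F := by
  simp only [card_filter]
  rw [sum_comm, card_eq_sum_ones, sum_mul]
  refine sum_congr rfl fun i _ => ?_
  rw [Fintype.sum_prod_type, sum_comm]
  have : ∀ d c : F, (a i + c = b i * d) ↔ (c = b i * d - a i) := fun d c => by
    rw [eq_sub_iff_add_eq, add_comm]
  simp [this]

/-- Subtracting the two equations determines `d` when `b ≠ b'`, and is contradictory when only `a ≠
a'`; for equal points `d` is free and determines `c`. -/
theorem card_common_lines_le (a b a' b' : F) :
    (univ.filter fun l : F × F => a + l.1 = b * l.2 ∧ a' + l.1 = b' * l.2).card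
      ≤ 1 + Fintype.card F * (if a = a' ∧ b = b' then 1 else 0) := by
  split_ifs with h
  · rw [mul_one]
    refine le_trans ?_ (Nat.le_add_left _ _)
    rw [← card_univ (α := F)]
    refine card_le_card_of_injOn (fun l => l.2) (by simp) ?_
    rintro ⟨c, d⟩ h1 ⟨c', d'⟩ h2 h3
    simp only [coe_filter, mem_univ, true_and, Set.mem_ofPred_eq] at h1 h2 h3
    subst h3
    rw [Prod.mk.injEq]
    exact ⟨add_left_cancel (h1.1.trans h2.1.symm), rfl⟩
  · rw [mul_zero, add_zero, card_le_one]
    rintro ⟨c, d⟩ h1 ⟨c', d'⟩ h2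
    simp only [mem_filter, mem_univ, true_and] at h1 h2
    have hb : b - b' ≠ 0 := by
      intro hb
      have hb := sub_eq_zero.1 hb
      subst hb
      exact h ⟨add_right_cancel (h1.1.trans h1.2.symm), rfl⟩
    have hd : d = d' := by
      apply mul_left_cancel₀ hb
      linear_combination h2.1 - h2.2 - h1.1 + h1.2
    subst hd
    rw [Prod.mk.injEq]
    exact ⟨add_left_cancel (h1.1.trans h2.1.symm), rfl⟩

theorem sum_sq_card_incidences_le {ι : Type*} (P : Finset ι) (a b : ι → F) (r : ℕ)
    (hr : ∀ i ∈ P, (P.filter fun j => a i = a j ∧ b i = b j).card ≤ r) :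
    ∑ l : F × F, (P.filter fun i => a i + l.1 = b i * l.2).card ^ 2
      ≤ P.card ^ 2 + Fintype.card F * (r * P.card) := by
  have h1 : ∀ l : F × F, (P.filter fun i => a i + l.1 = b i * l.2).card ^ 2
      = ∑ i ∈ P, ∑ j ∈ P,
        if a i + l.1 = b i * l.2 ∧ a j + l.1 = b j * l.2 then 1 else 0 := by
    intro l
    rw [sq, card_filter, sum_mul_sum]
    refine sum_congr rfl fun i _ => sum_congr rfl fun j _ => ?_
    by_cases h : a i + l.1 = b i * l.2 <;> by_cases h' : a j + l.1 = b j * l.2 <;> simp [h, h']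
  simp only [h1]
  rw [sum_comm]
  calc _ = ∑ i ∈ P, ∑ j ∈ P, (univ.filter fun l : F × F =>
        a i + l.1 = b i * l.2 ∧ a j + l.1 = b j * l.2).card := by
        refine sum_congr rfl fun i _ => ?_
        rw [sum_comm]
        refine sum_congr rfl fun j _ => ?_
        rw [card_filter]
    _ ≤ ∑ i ∈ P, ∑ j ∈ P, (1 + Fintype.card F * (if a i = a j ∧ b i = b j then 1 else 0)) :=
        sum_le_sum fun i _ => sum_le_sum fun j _ => card_common_lines_le _ _ _ _
    _ = ∑ i ∈ P, (P.card + Fintype.card F *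
          (P.filter fun j => a i = a j ∧ b i = b j).card) := by
        refine sum_congr rfl fun i _ => ?_
        rw [sum_add_distrib, ← mul_sum, card_filter]
        simp
    _ ≤ ∑ i ∈ P, (P.card + Fintype.card F * r) :=
        sum_le_sum fun i hi => by gcongr; exact hr i hi
    _ = _ := by
        rw [sum_const, smul_eq_mul]
        ring

/-- Variance over all `q ^ 2` lines: the mean is exactly `|P| / q`, so the main term `|P| ^ 2` of
the second moment cancels. -/
theorem sum_sq_card_incidences_sub_le {ι : Type*} (P : Finset ι) (a b : ι → F) (r : ℕ)
    (hr : ∀ i ∈ P, (P.filter fun j => a i = a j ∧ b i = b j).card ≤ r) :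
    ∑ l : F × F, (((P.filter fun i => a i + l.1 = b i * l.2).card : ℝ)
        - P.card / Fintype.card F) ^ 2
      ≤ Fintype.card F * (r * P.card) := by
  have h2 : (∑ l : F × F, ((P.filter fun i => a i + l.1 = b i * l.2).card : ℝ) ^ 2)
      ≤ (P.card : ℝ) ^ 2 + Fintype.card F * (r * P.card) := by
    exact_mod_cast sum_sq_card_incidences_le P a b r hr
  have h1 : (∑ l : F × F, ((P.filter fun i => a i + l.1 = b i * l.2).card : ℝ))
      = P.card * Fintype.card F := by
    exact_mod_cast sum_card_incidences P a b
  have hq : (Fintype.card F : ℝ) ≠ 0 := by exact_mod_cast Fintype.card_ne_zero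
  simp only [sub_sq, sum_add_distrib, sum_sub_distrib]
  rw [← sum_mul, ← mul_sum, h1, sum_const, card_univ, Fintype.card_prod, nsmul_eq_mul]
  have : 2 * ((P.card : ℝ) * Fintype.card F) * (P.card / Fintype.card F) = 2 * (P.card : ℝ) ^ 2 := by
    field_simp
  rw [this]
  have : ((Fintype.card F * Fintype.card F : ℕ) : ℝ) * ((P.card : ℝ) / Fintype.card F) ^ 2
      = (P.card : ℝ) ^ 2 := by
    push_cast
    field_simp
  rw [this]
  linarith

/-- Incidence bound over a finite field for points `(a, b)` and lines `(c, d)`, incident when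
`a + c = b * d`, where each point is repeated at most `r` times and each line at most `s` times. -/
theorem card_incidences_le {ι κ : Type*} (P : Finset ι) (L : Finset κ) (a b : ι → F) (c d : κ → F)
    (r s : ℕ) (hr : ∀ i ∈ P, (P.filter fun j => a i = a j ∧ b i = b j).card ≤ r)
    (hs : ∀ c' d', (L.filter fun j => c j = c' ∧ d j = d').card ≤ s) :
    (((P ×ˢ L).filter fun z => a z.1 + c z.2 = b z.1 * d z.2).card : ℝ)
      ≤ P.card * L.card / Fintype.card F
        + √(L.card * (s * (Fintype.card F * (r * P.card)))) := by
  -- The deviation of each line from the mean; Cauchy–Schwarz over `L` bounds its sum by the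
  -- variance.
  set e : F × F → ℝ := fun l =>
    ((P.filter fun i => a i + l.1 = b i * l.2).card : ℝ) - P.card / Fintype.card F with he
  have h1 : (((P ×ˢ L).filter fun z => a z.1 + c z.2 = b z.1 * d z.2).card : ℝ)
      = P.card * L.card / Fintype.card F + ∑ j ∈ L, e (c j, d j) := by
    rw [he, sum_sub_distrib, sum_const, nsmul_eq_mul, card_filter, sum_product_right]
    simp only [card_filter]
    push_cast
    ring
  rw [h1]
  gcongr
  apply Real.le_sqrt_of_sq_le
  refine sq_sum_le_card_mul_sum_sq.trans ?_
  gcongr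
  calc ∑ j ∈ L, e (c j, d j) ^ 2
      = ∑ l : F × F, ∑ j ∈ L with (c j, d j) = l, e (c j, d j) ^ 2 :=
        (sum_fiberwise _ _ _).symm
    _ = ∑ l : F × F, ((L.filter fun j => (c j, d j) = l).card : ℝ) * e l ^ 2 := by
        refine sum_congr rfl fun l _ => ?_
        rw [← nsmul_eq_mul, ← sum_const]
        refine sum_congr rfl fun j hj => ?_
        rw [(mem_filter.1 hj).2]
    _ ≤ ∑ l : F × F, (s : ℝ) * e l ^ 2 := by
        refine sum_le_sum fun l _ => ?_
        gcongr
        refine le_trans (card_le_card ?_) (hs l.1 l.2)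
        intro j hj
        simp only [mem_filter, Prod.ext_iff] at hj ⊢
        exact hj
    _ = s * ∑ l : F × F, e l ^ 2 := by rw [mul_sum]
    _ ≤ _ := by
        gcongr
        exact sum_sq_card_incidences_sub_le P a b r hr

end Incidence

/-! ### Collisions of the power-sum function and its shift -/

section PowerSum

variable {p : ℕ} [Fact p.Prime] {G : Subgroup (ZMod p)ˣ}

theorem card_filter_pow_eq_le {k : ℕ} (hk : 1 ≤ k) (A : Finset G) (c : ZMod p) :
    (A.filter fun x : G => ((x : (ZMod p)ˣ) : ZMod p) ^ k = c).card ≤ k := by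
  classical
  calc _ ≤ (Polynomial.nthRoots k c).toFinset.card := by
        refine card_le_card_of_injOn (fun x : G => ((x : (ZMod p)ˣ) : ZMod p)) ?_ ?_
        · intro x hx
          simp only [coe_filter, Set.mem_ofPred_eq] at hx
          simpa [Polynomial.mem_nthRoots hk] using hx.2
        · intro x _ y _ h
          exact Subtype.ext (Units.ext h)
    _ ≤ (Polynomial.nthRoots k c).card := Multiset.toFinset_card_le _
    _ ≤ k := Polynomial.card_nthRoots k c

theorem card_filter_eq_le_maxFiber (w : G → ZMod p) (A : Finset G) (t : ZMod p) :
    (A.filter fun x => w x = t).card ≤ maxFiber G w := by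
  classical
  unfold maxFiber
  refine le_trans (card_le_card ?_)
    (le_sup (f := fun t : ZMod p => (univ.filter fun x : G => w x = t).card) (mem_univ t))
  intro x
  simp +contextual

/-- Cancelling `g x` leaves an equation linear in `x ^ k` with leading coefficient `h y - h y'`; if
that vanishes, the equation forces `y ^ k = y' ^ k`. -/
theorem card_filter_powerSumFun_eq_le (g h : G → (ZMod p)ˣ) {k : ℕ} (hk : 1 ≤ k) (A : Finset G)
    {y y' : G} (hy : ((y : (ZMod p)ˣ) : ZMod p) ^ k ≠ ((y' : (ZMod p)ˣ) : ZMod p) ^ k) :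
    (A.filter fun x => powerSumFun G g h k x y = powerSumFun G g h k x y').card ≤ k := by
  have key : ∀ x : G, powerSumFun G g h k x y = powerSumFun G g h k x y' →
      ((h y : ZMod p) - h y') * ((x : (ZMod p)ˣ) : ZMod p) ^ k
        = h y' * ((y' : (ZMod p)ˣ) : ZMod p) ^ k - h y * ((y : (ZMod p)ˣ) : ZMod p) ^ k := by
    intro x hx
    apply mul_left_cancel₀ (g x).ne_zero
    unfold powerSumFun at hx
    linear_combination hx
  by_cases hh : (h y : ZMod p) - h y' = 0
  · rw [filter_false_of_mem]
    · simp
    · intro x _ hx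
      have h1 := key x hx
      rw [hh, zero_mul, ← sub_eq_zero.1 hh, ← mul_sub] at h1
      rcases mul_eq_zero.1 h1.symm with h2 | h2
      · exact (h y).ne_zero h2
      · exact hy (sub_eq_zero.1 h2).symm
  · refine le_trans (card_le_card ?_) (card_filter_pow_eq_le hk A
      ((h y' * ((y' : (ZMod p)ˣ) : ZMod p) ^ k - h y * ((y : (ZMod p)ˣ) : ZMod p) ^ k)
        / ((h y : ZMod p) - h y')))
    intro x hx
    rw [mem_filter] at hx ⊢
    refine ⟨hx.1, ?_⟩
    rw [eq_div_iff hh, mul_comm]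
    exact key x hx.2

/-- On average over `x`, the function `y ↦ f(x, y)` is boundedly many to one. -/
theorem card_collisions_powerSumFun_le (g h : G → (ZMod p)ˣ) {k : ℕ} (hk : 1 ≤ k)
    (A : Finset G) :
    ((A ×ˢ (A ×ˢ A)).filter fun z =>
      powerSumFun G g h k z.1 z.2.1 = powerSumFun G g h k z.1 z.2.2).card
      ≤ 2 * k * A.card ^ 2 := by
  rw [card_filter, sum_product_right]
  simp only [← card_filter]
  calc _ ≤ ∑ q ∈ A ×ˢ A, (k + if ((q.2 : (ZMod p)ˣ) : ZMod p) ^ k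
          = ((q.1 : (ZMod p)ˣ) : ZMod p) ^ k then A.card else 0) := by
        refine sum_le_sum fun q _ => ?_
        split_ifs with hq
        · exact (card_filter_le _ _).trans (Nat.le_add_left _ _)
        · exact card_filter_powerSumFun_eq_le g h hk A (Ne.symm hq)
    _ = A.card * A.card * k + ∑ y ∈ A, A.card * (A.filter fun y' : G =>
          ((y' : (ZMod p)ˣ) : ZMod p) ^ k = ((y : (ZMod p)ˣ) : ZMod p) ^ k).card := by
        rw [sum_add_distrib, sum_const, card_product, smul_eq_mul, sum_product]
        congr 1
        refine sum_congr rfl fun y _ => ?_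
        rw [card_filter, mul_sum]
        simp
    _ ≤ A.card * A.card * k + ∑ y ∈ A, A.card * k := by
        gcongr
        exact card_filter_pow_eq_le hk A _
    _ = _ := by
        rw [sum_const, smul_eq_mul]
        ring

/-- The pairs `(x, f(x, y))` with `w(x) ≠ 0` and `f(x, y) ≠ 0`. -/
def valuePairs (g h : G → (ZMod p)ˣ) (k : ℕ) (w : G → ZMod p) (A : Finset G) :
    Finset (G × ZMod p) :=
  ((A ×ˢ A).filter fun q => w q.1 ≠ 0 ∧ powerSumFun G g h k q.1 q.2 ≠ 0).image
    fun q => (q.1, powerSumFun G g h k q.1 q.2)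

theorem powerSumFun_eq_zero_iff (g h : G → (ZMod p)ˣ) (k : ℕ) (x y : G) :
    powerSumFun G g h k x y = 0 ↔
      ((y : (ZMod p)ˣ) : ZMod p) ^ k = -((x : (ZMod p)ˣ) : ZMod p) ^ k := by
  unfold powerSumFun
  rw [mul_eq_zero, or_iff_right (mul_ne_zero (g x).ne_zero (h y).ne_zero), add_comm,
    add_eq_zero_iff_eq_neg]

theorem sq_card_le_two_mul_card_nonzero (g h : G → (ZMod p)ˣ) {k M : ℕ} (hk : 1 ≤ k)
    (w : G → ZMod p) (hw : maxFiber G w ≤ M) (A : Finset G) (hA : 2 * (M + k) ≤ A.card) :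
    A.card ^ 2 ≤ 2 * ((A ×ˢ A).filter fun q =>
      w q.1 ≠ 0 ∧ powerSumFun G g h k q.1 q.2 ≠ 0).card := by
  have h1 := card_filter_add_card_filter_not (s := A ×ˢ A) fun q : G × G =>
    w q.1 ≠ 0 ∧ powerSumFun G g h k q.1 q.2 ≠ 0
  have h2 : ((A ×ˢ A).filter fun q : G × G =>
      ¬ (w q.1 ≠ 0 ∧ powerSumFun G g h k q.1 q.2 ≠ 0)).card ≤ A.card * (M + k) := by
    calc _ ≤ ∑ q ∈ A ×ˢ A, ((if w q.1 = 0 then 1 else 0) +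
          if powerSumFun G g h k q.1 q.2 = 0 then 1 else 0) := by
          rw [card_filter]
          refine sum_le_sum fun q _ => ?_
          by_cases hq : w q.1 = 0 <;> by_cases hq' : powerSumFun G g h k q.1 q.2 = 0 <;>
            simp [hq, hq']
      _ = A.card * (A.filter fun x => w x = 0).card +
          ∑ x ∈ A, (A.filter fun y : G => ((y : (ZMod p)ˣ) : ZMod p) ^ k
            = -((x : (ZMod p)ˣ) : ZMod p) ^ k).card := by
          rw [sum_add_distrib, sum_product_right, sum_product]
          simp only [powerSumFun_eq_zero_iff, card_filter]
          congr 1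
          exact sum_const (∑ x ∈ A, if w x = 0 then 1 else 0)
      _ ≤ A.card * M + ∑ x ∈ A, k := by
          gcongr
          · exact (card_filter_eq_le_maxFiber w A 0).trans hw
          · exact card_filter_pow_eq_le hk A _
      _ = _ := by
          rw [sum_const, smul_eq_mul]
          ring
  rw [card_product] at h1
  nlinarith

theorem sq_card_le_mul_card_valuePairs (g h : G → (ZMod p)ˣ) {k M : ℕ} (hk : 1 ≤ k)
    (w : G → ZMod p) (hw : maxFiber G w ≤ M) (A : Finset G) (hA : 2 * (M + k) ≤ A.card) :
    A.card ^ 2 ≤ 8 * k * (valuePairs g h k w A).card := by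
  set B := (A ×ˢ A).filter fun q => w q.1 ≠ 0 ∧ powerSumFun G g h k q.1 q.2 ≠ 0 with hB
  have h1 := sq_card_le_two_mul_card_nonzero g h hk w hw A hA
  have h2 := card_sq_le_card_mul_card_collisions B (valuePairs g h k w A)
    (fun q => (q.1, powerSumFun G g h k q.1 q.2)) fun q hq => mem_image_of_mem _ hq
  have h3 : ((B ×ˢ B).filter fun z => (z.1.1, powerSumFun G g h k z.1.1 z.1.2)
      = (z.2.1, powerSumFun G g h k z.2.1 z.2.2)).card ≤ 2 * k * A.card ^ 2 := by
    refine le_trans ?_ (card_collisions_powerSumFun_le g h hk A)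
    refine card_le_card_of_injOn (fun z => (z.1.1, (z.1.2, z.2.2))) ?_ ?_
    · rintro ⟨⟨x, y⟩, ⟨x', y'⟩⟩ hz
      simp only [hB, coe_filter, mem_product, mem_filter, Set.mem_ofPred_eq, Prod.mk.injEq] at hz ⊢
      grind
    · rintro ⟨⟨x, y⟩, ⟨x', y'⟩⟩ hz ⟨⟨u, v⟩, ⟨u', v'⟩⟩ hz' he
      simp only [coe_filter, Set.mem_ofPred_eq, Prod.mk.injEq] at hz hz' he ⊢
      grind
  rw [← hB] at h1
  rcases Nat.eq_zero_or_pos A.card with h0 | h0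
  · simp [h0]
  · have h4 : B.card ^ 2 ≤ (valuePairs g h k w A).card * (2 * k * A.card ^ 2) :=
      h2.trans (Nat.mul_le_mul_left _ h3)
    have h5 : 0 < A.card ^ 2 := by positivity
    refine Nat.le_of_mul_le_mul_left ?_ h5
    nlinarith

/-- Two value pairs with the same product `w(x) s` give a point-line incidence. -/
theorem card_collisions_valuePairs_le (g h : G → (ZMod p)ˣ) {k M : ℕ} (hk : 1 ≤ k)
    (w : G → ZMod p) (hw : maxFiber G w ≤ M) (A : Finset G) :
    (((valuePairs g h k w A ×ˢ valuePairs g h k w A).filter fun z =>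
        w z.1.1 * z.1.2 = w z.2.1 * z.2.2).card : ℝ)
      ≤ A.card ^ 2 * (A.card * (image₂ (powerSumFun G g h k) A A).card) / p
        + √(A.card * (image₂ (powerSumFun G g h k) A A).card
            * (k * (p * ((k * M : ℕ) * A.card ^ 2)))) := by
  set S := image₂ (powerSumFun G g h k) A A with hS
  -- The point coordinate `b` divides by `w x`.
  set A₀ := A.filter fun x => w x ≠ 0 with hA₀
  have hA₀A : A₀.card ≤ A.card := card_filter_le _ _
  set a : G × G → ZMod p := fun i => ((i.1 : (ZMod p)ˣ) : ZMod p) ^ k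
  set b : G × G → ZMod p := fun i => w i.2 / (w i.1 * g i.1)
  set c : G × ZMod p → ZMod p := fun j => ((j.1 : (ZMod p)ˣ) : ZMod p) ^ k
  set d : G × ZMod p → ZMod p := fun j => j.2 / h j.1
  -- The first coordinate leaves at most `k` choices of `x`; the second then fixes `w x'`, leaving
  -- at most `M` choices of `x'`.
  have hr : ∀ i ∈ A₀ ×ˢ A₀, ((A₀ ×ˢ A₀).filter fun j => a i = a j ∧ b i = b j).card ≤ k * M := by
    rintro ⟨x, x'⟩ hx
    calc _ ≤ ∑ u ∈ A₀.filter (fun u : G => ((u : (ZMod p)ˣ) : ZMod p) ^ k = ((x : (ZMod p)ˣ) : ZMod p) ^ k),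
            (A₀.filter fun u' => w u' = b (x, x') * (w u * g u)).card := by
          rw [← card_sigma]
          refine card_le_card_of_injOn (fun j => ⟨j.1, j.2⟩) ?_ ?_
          · rintro ⟨u, u'⟩ hu
            simp only [coe_filter, mem_product, Set.mem_ofPred_eq, coe_sigma, Set.mem_sigma_iff]
              at hu ⊢
            refine ⟨⟨hu.1.1, hu.2.1.symm⟩, hu.1.2, ?_⟩
            rw [hu.2.2, div_mul_cancel₀]
            exact mul_ne_zero (mem_filter.1 hu.1.1).2 (g u).ne_zero
          · rintro ⟨u, u'⟩ _ ⟨v, v'⟩ _ he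
            simpa using he
      _ ≤ ∑ u ∈ A₀.filter (fun u : G => ((u : (ZMod p)ˣ) : ZMod p) ^ k = ((x : (ZMod p)ˣ) : ZMod p) ^ k), M :=
          sum_le_sum fun u _ => (card_filter_eq_le_maxFiber w A₀ _).trans hw
      _ ≤ k * M := by
          rw [sum_const, smul_eq_mul]
          exact Nat.mul_le_mul_right _ (card_filter_pow_eq_le hk A₀ _)
  have hs : ∀ c' d', ((A ×ˢ S).filter fun j => c j = c' ∧ d j = d').card ≤ k := by
    intro c' d'
    refine le_trans ?_ (card_filter_pow_eq_le hk A c')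
    refine card_le_card_of_injOn (fun j : G × ZMod p => j.1) ?_ ?_
    · rintro ⟨y, s⟩ hy
      simp only [coe_filter, mem_product, Set.mem_ofPred_eq] at hy ⊢
      exact ⟨hy.1.1, hy.2.1⟩
    · rintro ⟨y, s⟩ hy ⟨y', s'⟩ hy' he
      simp only [coe_filter, Set.mem_ofPred_eq] at hy hy' he
      subst he
      have : s = s' := (div_left_inj' (h y).ne_zero).1 (hy.2.2.trans hy'.2.2.symm)
      rw [this]
  have hI := card_incidences_le (A₀ ×ˢ A₀) (A ×ˢ S) a b c d (k * M) k hr hs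
  rw [ZMod.card, card_product, card_product] at hI
  have hJ : ((valuePairs g h k w A ×ˢ valuePairs g h k w A).filter fun z =>
        w z.1.1 * z.1.2 = w z.2.1 * z.2.2).card ≤
      (((A₀ ×ˢ A₀) ×ˢ (A ×ˢ S)).filter fun z => a z.1 + c z.2 = b z.1 * d z.2).card := by
    -- Each collision lifts to an incidence by choosing `y` with `s = f(x, y)`.
    refine card_le_card_of_surjOn
      (fun z => ((z.1.1, powerSumFun G g h k z.1.1 z.2.1), (z.1.2, z.2.2))) ?_
    rintro ⟨⟨x, s⟩, ⟨x', s'⟩⟩ hz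
    simp only [valuePairs, coe_filter, mem_product, mem_image, mem_filter, Set.mem_ofPred_eq,
      Prod.exists, Prod.mk.injEq] at hz
    obtain ⟨⟨⟨u, y, ⟨⟨hu, hy⟩, hwu, -⟩, rfl, rfl⟩, ⟨u', y', ⟨⟨hu', hy'⟩, hwu', -⟩, rfl, rfl⟩⟩, he⟩ :=
      hz
    refine ⟨((u, u'), (y, powerSumFun G g h k u' y')), ?_, rfl⟩
    simp only [coe_filter, mem_product, Set.mem_ofPred_eq, hA₀, mem_filter]
    refine ⟨⟨⟨⟨hu, hwu⟩, hu', hwu'⟩, hy, mem_image₂_of_mem hu' hy'⟩, ?_⟩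
    simp only [a, b, c, d]
    rw [div_mul_div_comm, ← he, eq_div_iff
      (mul_ne_zero (mul_ne_zero hwu (g u).ne_zero) (h y).ne_zero)]
    simp only [powerSumFun]
    ring
  refine (Nat.cast_le.2 hJ).trans (hI.trans ?_)
  push_cast
  have : (A₀.card : ℝ) * A₀.card ≤ A.card ^ 2 := by
    rw [sq]
    gcongr
  gcongr

/-- The inequality between `#A`, `#f(A, A)`, `#P_w(f)(A, A)` and `p` behind the expansion. -/
theorem card_pow_four_le (g h : G → (ZMod p)ˣ) {k M : ℕ} (hk : 1 ≤ k)
    (w : G → ZMod p) (hw : maxFiber G w ≤ M) (A : Finset G) (hA : 2 * (M + k) ≤ A.card) {X : ℝ}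
    (hS : ((image₂ (powerSumFun G g h k) A A).card : ℝ) ≤ X)
    (hT : ((image₂ (mulShift w (powerSumFun G g h k)) A A).card : ℝ) ≤ X) :
    (A.card : ℝ) ^ 4 ≤ (8 * k) ^ 2 * (X * (A.card ^ 2 * (A.card * X) / p
        + √(A.card * X * (k * (p * ((k * M : ℕ) * A.card ^ 2)))))) := by
  have h1 : (A.card : ℝ) ^ 2 ≤ 8 * k * (valuePairs g h k w A).card := by
    exact_mod_cast sq_card_le_mul_card_valuePairs g h hk w hw A hA
  have h2 := card_sq_le_card_mul_card_collisions (valuePairs g h k w A)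
      (image₂ (mulShift w (powerSumFun G g h k)) A A) (fun z => w z.1 * z.2) <| by
        rintro ⟨x, s⟩ hz
        simp only [valuePairs, mem_image, mem_filter, mem_product, Prod.exists,
          Prod.mk.injEq] at hz
        obtain ⟨u, y, ⟨⟨hu, hy⟩, -⟩, rfl, rfl⟩ := hz
        exact mem_image₂_of_mem hu hy
  rw [← Nat.cast_le (α := ℝ)] at h2
  push_cast at h2
  have h3 := card_collisions_valuePairs_le g h hk w hw A
  have hX : 0 ≤ X := le_trans (by positivity) hS
  calc (A.card : ℝ) ^ 4 = ((A.card : ℝ) ^ 2) ^ 2 := by ring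
    _ ≤ (8 * k * (valuePairs g h k w A).card : ℝ) ^ 2 := by gcongr
    _ = (8 * k : ℝ) ^ 2 * ((valuePairs g h k w A).card : ℝ) ^ 2 := by ring
    _ ≤ _ := by
      gcongr
      refine h2.trans (mul_le_mul hT (h3.trans ?_) (by positivity) hX)
      gcongr

end PowerSum

/-! ### From the inequality to an exponent -/

/-- The two regimes of `card_pow_four_le`, with constants made explicit. -/
theorem le_or_le_of_pow_four_le {N X P C D : ℝ} (hN : 0 < N) (hX : 0 ≤ X) (hP : 0 < P)
    (hD : 0 ≤ D)
    (H : N ^ 4 ≤ C * (X * (N ^ 2 * (N * X) / P + √(N * X * (D * (P * N ^ 2)))))) :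
    N * P ≤ 2 * C * X ^ 2 ∨ N ^ 5 ≤ 4 * C ^ 2 * D * P * X ^ 3 := by
  by_contra! hcon
  obtain ⟨h1, h2⟩ := hcon
  -- If both alternatives fail, each summand is below half of `N ^ 4`.
  have e1 : C * (X * (N ^ 2 * (N * X) / P)) < N ^ 4 / 2 := by
    have : C * (X * (N ^ 2 * (N * X) / P)) = N ^ 3 * (2 * C * X ^ 2) / (2 * P) := by
      field_simp
    rw [this, div_lt_iff₀ (by positivity)]
    have := mul_lt_mul_of_pos_left h1 (pow_pos hN 3)
    linarith
  have e2 : C * (X * √(N * X * (D * (P * N ^ 2)))) < N ^ 4 / 2 := by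
    refine lt_of_pow_lt_pow_left₀ 2 (by positivity) ?_
    rw [mul_pow, mul_pow, Real.sq_sqrt (by positivity)]
    have := mul_lt_mul_of_pos_left h2 (pow_pos hN 3)
    linarith
  rw [mul_add, mul_add] at H
  linarith

theorem mul_rpow_le_of_sq_le {α c N P X C : ℝ} (hα : 0 < α) (hc : 0 < c) (hN : 1 ≤ N)
    (hP : 0 < P) (hX : 0 ≤ X) (hC : 0 < C) (hNP : N < c * P ^ α) {δ : ℝ}
    (hδ : 2 * δ ≤ 1 / α - 1) (H : N * P ≤ C * X ^ 2) :
    √((1 / c) ^ (1 / α) / C) * N ^ (1 + δ) ≤ X := by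
  have hN0 : 0 < N := by linarith
  have h1 : (1 / c) ^ (1 / α) * N ^ (1 / α) ≤ P := by
    rw [← Real.mul_rpow (by positivity) hN0.le]
    calc (1 / c * N) ^ (1 / α) ≤ (P ^ α) ^ (1 / α) := by
          apply Real.rpow_le_rpow (by positivity) _ (by positivity)
          rw [one_div, inv_mul_le_iff₀ hc]
          exact hNP.le
      _ = P := by rw [← Real.rpow_mul hP.le, mul_one_div_cancel hα.ne', Real.rpow_one]
  refine le_of_pow_le_pow_left₀ (n := 2) (by norm_num) hX ?_
  rw [mul_pow, Real.sq_sqrt (by positivity), ← Real.rpow_natCast, ← Real.rpow_mul hN0.le,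
    div_mul_eq_mul_div, div_le_iff₀ hC]
  calc (1 / c) ^ (1 / α) * N ^ ((1 + δ) * (2 : ℕ))
      ≤ (1 / c) ^ (1 / α) * N ^ (1 + 1 / α) := by
        gcongr
        push_cast
        linarith
    _ = N * ((1 / c) ^ (1 / α) * N ^ (1 / α)) := by
        rw [Real.rpow_add hN0, Real.rpow_one]
        ring
    _ ≤ N * P := by gcongr
    _ ≤ X ^ 2 * C := by rwa [mul_comm (X ^ 2)]

/-- Substituting `P ≪ N ^ (1 / α)` gives `X ^ 3 ≫ N ^ (5 - 1 / α)`, a gain of up to `(2 - 1 / α) /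
3` in the exponent. -/
theorem mul_rpow_le_of_pow_three_le {α c N P X C : ℝ} (hα : 0 < α) (hc : 0 < c) (hN : 1 ≤ N)
    (hP : 0 < P) (hX : 0 ≤ X) (hC : 0 < C) (hNP : c * P ^ α < N) {δ : ℝ}
    (hδ : 3 * δ ≤ 2 - 1 / α) (H : N ^ 5 ≤ C * P * X ^ 3) :
    (1 / (C * (1 / c) ^ (1 / α))) ^ (1 / 3 : ℝ) * N ^ (1 + δ) ≤ X := by
  have hN0 : 0 < N := by linarith
  have h1 : P ≤ (1 / c) ^ (1 / α) * N ^ (1 / α) := by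
    rw [← Real.mul_rpow (by positivity) hN0.le]
    calc P = (P ^ α) ^ (1 / α) := by
          rw [← Real.rpow_mul hP.le, mul_one_div_cancel hα.ne', Real.rpow_one]
      _ ≤ (1 / c * N) ^ (1 / α) := by
          apply Real.rpow_le_rpow (by positivity) _ (by positivity)
          rw [one_div, le_inv_mul_iff₀ hc]
          exact hNP.le
  refine le_of_pow_le_pow_left₀ (n := 3) (by norm_num) hX ?_
  rw [mul_pow, ← Real.rpow_natCast, ← Real.rpow_mul (by positivity),
    ← Real.rpow_natCast (N ^ (1 + δ)), ← Real.rpow_mul hN0.le]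
  norm_num only [Nat.cast_ofNat, Real.rpow_one]
  rw [one_div_mul_eq_div, div_le_iff₀ (by positivity)]
  have h2 : N ^ ((1 + δ) * 3) * N ^ (1 / α) ≤ N ^ 5 := by
    rw [← Real.rpow_add hN0, ← Real.rpow_natCast N 5]
    apply Real.rpow_le_rpow_of_exponent_le hN
    push_cast
    linarith
  have h3 : 0 < N ^ (1 / α) := by positivity
  refine le_of_mul_le_mul_right ?_ h3
  calc N ^ ((1 + δ) * 3) * N ^ (1 / α) ≤ C * P * X ^ 3 := h2.trans H
    _ ≤ C * ((1 / c) ^ (1 / α) * N ^ (1 / α)) * X ^ 3 := by gcongr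
    _ = _ := by ring

theorem theorem2p5 (α : ℝ) (hα : 1 / 2 < α) (hα' : α < 1) :
    ∃ Δ : ℝ, Δ = min (2 - 1 / α) (1 / α - 1) / 40 ∧ 0 < Δ ∧
      ∀ (k : ℕ), 1 ≤ k → ∀ (M : ℕ) (c₁ c₂ : ℝ), 0 < c₁ → c₁ < c₂ →
        ∃ κ : ℝ, 0 < κ ∧
          ∀ (p : ℕ) [Fact p.Prime] (G : Subgroup (ZMod p)ˣ) (g h : G → (ZMod p)ˣ)
            (w : G → ZMod p) (A : Finset G),
            IsAdmissiblePair G g h M →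
            maxFiber G w ≤ M →
            c₁ * (p : ℝ) ^ α < (A.card : ℝ) →
            (A.card : ℝ) < c₂ * (p : ℝ) ^ α →
            κ * (A.card : ℝ) ^ (1 + Δ) ≤
              max ((Finset.image₂ (powerSumFun G g h k) A A).card : ℝ)
                ((Finset.image₂ (mulShift w (powerSumFun G g h k)) A A).card : ℝ) := by
  have hα0 : 0 < α := by linarith
  have hinv2 : 1 / α < 2 := by
    rw [div_lt_iff₀ hα0]
    linarith
  have hinv1 : 1 < 1 / α := by
    rw [lt_div_iff₀ hα0]
    linarith
  have hmin : 0 < min (2 - 1 / α) (1 / α - 1) := lt_min (by linarith) (by linarith)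
  have hmin1 := min_le_left (2 - 1 / α) (1 / α - 1)
  have hmin2 := min_le_right (2 - 1 / α) (1 / α - 1)
  refine ⟨_, rfl, by positivity, ?_⟩
  -- The two regimes only need `Δ ≤ (1 / α - 1) / 2` and `Δ ≤ (2 - 1 / α) / 3`, so `1 / 40` leaves
  -- ample room.
  set Δ := min (2 - 1 / α) (1 / α - 1) / 40 with hΔ
  intro k hk M c₁ c₂ hc₁ hc
  have hc₂ : 0 < c₂ := hc₁.trans hc
  set C : ℝ := (8 * k) ^ 2
  -- `M + 1` instead of `M` keeps `D`, and hence `κ₂`, positive when `M = 0`.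
  set D : ℝ := k * (k * (M + 1))
  set κ₀ : ℝ := (1 / (2 * (M + k) : ℝ)) ^ (1 + Δ)
  set κ₁ : ℝ := √((1 / c₂) ^ (1 / α) / (2 * C))
  set κ₂ : ℝ := (1 / (4 * C ^ 2 * D * (1 / c₁) ^ (1 / α))) ^ (1 / 3 : ℝ)
  have hk0 : (0 : ℝ) < k := by exact_mod_cast hk
  have hC : 0 < C := by positivity
  have hD : 0 < D := by positivity
  refine ⟨min κ₀ (min κ₁ κ₂), by positivity, ?_⟩
  intro p _ G g h w A _ hw hA₁ hA₂
  have hp : (0 : ℝ) < p := by exact_mod_cast (Fact.out : p.Prime).pos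
  have hA0 : (0 : ℝ) < A.card := lt_trans (by positivity) hA₁
  have hApos : 0 < A.card := by exact_mod_cast hA0
  have hA1 : (1 : ℝ) ≤ A.card := by exact_mod_cast hApos
  set X := max ((Finset.image₂ (powerSumFun G g h k) A A).card : ℝ)
    ((Finset.image₂ (mulShift w (powerSumFun G g h k)) A A).card : ℝ) with hX
  have hX1 : 1 ≤ X := by
    refine le_max_of_le_left ?_
    have hne := card_pos.1 hApos
    exact_mod_cast card_pos.2 (hne.image₂ hne)
  have hX0 : 0 ≤ X := by linarith
  have hpow : 0 ≤ (A.card : ℝ) ^ (1 + Δ) := by positivity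
  by_cases hlarge : 2 * (M + k) ≤ A.card
  · have H := card_pow_four_le g h hk w hw A hlarge (le_max_left _ _) (le_max_right _ _)
    rw [← hX] at H
    have H' : (A.card : ℝ) ^ 4 ≤ C * (X * ((A.card : ℝ) ^ 2 * (A.card * X) / p
        + √(A.card * X * (D * (p * (A.card : ℝ) ^ 2))))) := by
      refine H.trans ?_
      have : (k : ℝ) * (p * ((k * M : ℕ) * (A.card : ℝ) ^ 2))
          ≤ D * (p * (A.card : ℝ) ^ 2) := by
        calc _ = (k : ℝ) * (k * M) * (p * (A.card : ℝ) ^ 2) := by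
              push_cast
              ring
          _ ≤ _ := by
              gcongr
              linarith
      gcongr
    rcases le_or_le_of_pow_four_le hA0 hX0 hp hD.le H' with h1 | h1
    · refine le_trans ?_ (mul_rpow_le_of_sq_le (δ := Δ) hα0 hc₂ hA1 hp hX0 (by positivity) hA₂
        (by linarith) h1)
      gcongr
      exact (min_le_right _ _).trans (min_le_left _ _)
    · refine le_trans ?_ (mul_rpow_le_of_pow_three_le (δ := Δ) hα0 hc₁ hA1 hp hX0
        (by positivity) hA₁ (by linarith) h1)
      gcongr
      exact (min_le_right _ _).trans (min_le_right _ _)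
  -- Bounded `|A|`: the trivial bound `1 ≤ X` suffices, by the choice of `κ₀`.
  · refine le_trans ?_ hX1
    calc _ ≤ κ₀ * (A.card : ℝ) ^ (1 + Δ) := by
          gcongr
          exact min_le_left _ _
      _ = (1 / (2 * (M + k) : ℝ) * A.card) ^ (1 + Δ) := by
          rw [Real.mul_rpow (by positivity) hA0.le]
      _ ≤ 1 := by
          refine Real.rpow_le_one (by positivity) ?_ (by positivity)
          rw [one_div_mul_eq_div, div_le_one (by positivity)]
          exact_mod_cast (not_le.1 hlarge).le
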